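/- Let $\mathbb D$ be the open unit disc and $\mathrm{Hol}(\mathbb D)$ the Fréchet space of holomorphic functions on $\mathbb D$ with the topology of uniform convergence on compact sets. Let $\varphi:\mathbb D\to\mathbb D$ be holomorphic, not an automorphism of $\mathbb D$, with a fixed point $\alpha\in\mathbb D$ such that $\varphi'(\alpha)\neq 0$. Put $\lambda_n=\varphi'(\alpha)^n$ for $n\in\mathbb N_0=\{0,1,2,\dots\}$, let $C_\varphi f=f\circ\varphi$ on $\mathrm{Hol}(\mathbb D)$, and let $\kappa\in\mathrm{Hol}(\mathbb D)$ be Koenigs' eigenfunction, i.e. the unique function with $\kappa\circ\varphi=\varphi'(\alpha)\kappa$ and $\kappa'(\alpha)=1$. Define $P_n:\mathrm{Hol}(\mathbb D)\to\mathrm{Hol}(\mathbb D)$ recursively by $$P_0f=f(\alpha)\cdot 1,\qquad P_nf=\frac1{n!}\Big(f-\sum_{k=0}^{n-1}P_kf\Big)^{(n)}(\alpha)\,\kappa^n\quad(n\ge 1).$$ Let $X$ be a complex Banach space continuously embedded in $\mathrm{Hol}(\mathbb D)$ (a subspace of $\mathrm{Hol}(\mathbb D)$ with continuous inclusion) such that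 $C_\varphi X\subset X$, and let $T=C_\varphi|_X$, a bounded operator on $X$. For an isolated point $\mu$ of $\sigma(T)$, the associated spectral projection is the residue of the resolvent at $\mu$, $$P=\frac1{2\pi i}\oint_{|\lambda-\mu|=\varepsilon}(\lambda\,\mathrm{Id}-T)^{-1}\,d\lambda ,$$ where $\varepsilon>0$ is any radius with $\sigma(T)\cap\{|\lambda-\mu|\le\varepsilon\}=\{\mu\}$; $\mu$ is called a simple pole if $P$ has one-dimensional range and the resolvent has a pole of order one at $\mu$. Let $\mu\in\mathbb C\setminus\{0\}$ be an isolated point of $\sigma(T)$. Then there exists $n\in\mathbb N_0$ such that $\mu=\lambda_n$, and $\mu$ is a simple pole. Moreover, $P_nX\subset X$ and $P_n|_X$ is the spectral projection associated with $\mu$. -/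

import Mathlib

namespace HolDisc

open Metric

noncomputable section

/-- The open unit disc, as a type. -/
abbrev Disc : Type := ball (0 : ℂ) 1

/-- The extension by `0` to `ℂ` of a function on the open unit disc; it only serves to apply the
calculus of functions `ℂ → ℂ` at points of the (open) disc. -/
def zeroExt (f : Disc → ℂ) : ℂ → ℂ := Function.extend Subtype.val f 0

theorem zeroExt_coe (f : Disc → ℂ) (z : Disc) : zeroExt f z = f z :=
  Subtype.val_injective.extend_apply f 0 z

/-- Holomorphy of a function on the open unit disc. -/
def IsHol (f : Disc → ℂ) : Prop := DifferentiableOn ℂ (zeroExt f) (ball 0 1)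

theorem isHol_of_eqOn {f : Disc → ℂ} {F : ℂ → ℂ} (hF : DifferentiableOn ℂ F (ball 0 1))
    (h : ∀ z : Disc, f z = F z) : IsHol f :=
  hF.congr fun z hz => (zeroExt_coe f ⟨z, hz⟩).trans (h ⟨z, hz⟩)

theorem IsHol.continuous {f : Disc → ℂ} (hf : IsHol f) : Continuous f := by
  have h := hf.continuousOn.comp_continuous continuous_subtype_val fun z : Disc => z.2
  exact h.congr fun z => zeroExt_coe f z

/-- `Hol(𝔻)`, as an algebra under pointwise operations. Its topology is the one induced by the
compact-open topology of `C(𝔻, ℂ)`, i.e. uniform convergence on the compact subsets of `𝔻`. -/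
def Hol : Subalgebra ℂ C(Disc, ℂ) where
  carrier := {f | IsHol f}
  mul_mem' {f g} hf hg := isHol_of_eqOn (F := fun z => zeroExt f z * zeroExt g z)
    (DifferentiableOn.mul hf hg) fun z => by simp [zeroExt_coe]
  add_mem' {f g} hf hg := isHol_of_eqOn (F := fun z => zeroExt f z + zeroExt g z)
    (DifferentiableOn.add hf hg) fun z => by simp [zeroExt_coe]
  algebraMap_mem' c := isHol_of_eqOn (F := fun _ => c) (differentiableOn_const c) fun z => rfl

/-- The value of `f ∈ Hol(𝔻)` at `z ∈ 𝔻`. -/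
instance : CoeFun Hol (fun _ => Disc → ℂ) := ⟨fun f => (f : C(Disc, ℂ))⟩

/-- The `n`-th complex derivative at a point `α` of the disc. -/
def derivAt (n : ℕ) (f : Disc → ℂ) (α : Disc) : ℂ := iteratedDeriv n (zeroExt f) (α : ℂ)

/-- Holomorphy of a self-map of the disc. -/
def IsHolSelfMap (φ : Disc → Disc) : Prop := IsHol fun z => (φ z : ℂ)

/-- `φ` is an automorphism of the disc: it is holomorphic with a holomorphic inverse. -/
def IsAut (φ : Disc → Disc) : Prop :=
  IsHolSelfMap φ ∧ ∃ ψ : Disc → Disc,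
    IsHolSelfMap ψ ∧ Function.LeftInverse ψ φ ∧ Function.RightInverse ψ φ

/-- `φ` is a Schröder map with interior fixed point `α`. -/
structure IsSchroeder (φ : Disc → Disc) (α : Disc) : Prop where
  hol : IsHolSelfMap φ
  not_aut : ¬ IsAut φ
  fixed : φ α = α
  deriv_ne_zero : derivAt 1 (fun z => (φ z : ℂ)) α ≠ 0

/-- `λ_n = φ'(α) ^ n`. -/
def eigenval (φ : Disc → Disc) (α : Disc) (n : ℕ) : ℂ :=
  derivAt 1 (fun z => (φ z : ℂ)) α ^ n

theorem isHol_comp {φ : Disc → Disc} (hφ : IsHolSelfMap φ) {f : Disc → ℂ} (hf : IsHol f) :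
    IsHol (f ∘ φ) := by
  refine isHol_of_eqOn (F := zeroExt f ∘ zeroExt fun z => (φ z : ℂ))
    (DifferentiableOn.comp hf hφ fun z hz => ?_) fun z => ?_
  · have h := zeroExt_coe (fun z => (φ z : ℂ)) ⟨z, hz⟩
    simp only at h
    rw [h]
    exact (φ ⟨z, hz⟩).2
  · simp [zeroExt_coe]

/-- The composition operator `C_φ f = f ∘ φ` on `Hol(𝔻)`. -/
def compOp (φ : Disc → Disc) (hφ : IsHolSelfMap φ) : Hol →L[ℂ] Hol where
  toFun f := ⟨(f : C(Disc, ℂ)).comp ⟨φ, continuous_induced_rng.2 (IsHol.continuous hφ)⟩,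
    isHol_comp hφ f.2⟩
  map_add' _ _ := rfl
  map_smul' _ _ := rfl
  cont := ((ContinuousMap.continuous_precomp _).comp continuous_subtype_val).subtype_mk _

theorem compOp_apply (φ : Disc → Disc) (hφ : IsHolSelfMap φ) (f : Hol) (z : Disc) :
    compOp φ hφ f z = f (φ z) := rfl

/-- `κ ∘ φ = φ'(α) κ` and `κ'(α) = 1`. -/
def IsKoenigs (φ : Disc → Disc) (α : Disc) (κ : Hol) : Prop :=
  (∀ z, κ (φ z) = derivAt 1 (fun w => (φ w : ℂ)) α * κ z) ∧ derivAt 1 κ α = 1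

/-- Koenigs' eigenfunction: the element of `Hol(𝔻)` with the defining property `IsKoenigs`
(for a Schröder map there is exactly one). -/
def koenigs (φ : Disc → Disc) (α : Disc) : Hol := Classical.epsilon (IsKoenigs φ α)

/-- The projections `P_n f = (1 / n!) g^{(n)}(α) κ ^ n` with `g = f - ∑_{k < n} P_k f`.
For `n = 0` this reads `P_0 f = f(α) 1`. -/
def koenigsProj (φ : Disc → Disc) (α : Disc) (n : ℕ) (f : Hol) : Hol :=
  ((n.factorial : ℂ)⁻¹ * derivAt n (f - ∑ k : Fin n, koenigsProj φ α k f : Hol) α) •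
    koenigs φ α ^ n
termination_by n
decreasing_by exact k.2

theorem koenigsProj_zero (φ : Disc → Disc) (α : Disc) (f : Hol) :
    koenigsProj φ α 0 f = f α • (1 : Hol) := by
  rw [koenigsProj]
  simp [derivAt, zeroExt_coe]

section Restriction

variable {X : Type*} [NormedAddCommGroup X] [NormedSpace ℂ X]

/-- The linear map underlying `restrictOp`. -/
def restrictLin (φ : Disc → Disc) (hφ : IsHolSelfMap φ) (ι : X →L[ℂ] Hol)
    (hι : Function.Injective ι) (hinv : ∀ x, ∃ y, ι y = compOp φ hφ (ι x)) : X →ₗ[ℂ] X where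
  toFun x := (hinv x).choose
  map_add' x y := hι <| (hinv (x + y)).choose_spec.trans <| by
    rw [map_add ι (hinv x).choose, (hinv x).choose_spec, (hinv y).choose_spec, map_add, map_add]
  map_smul' c x := hι <| (hinv (c • x)).choose_spec.trans <| by
    rw [RingHom.id_apply, map_smul ι c (hinv x).choose, (hinv x).choose_spec, map_smul, map_smul]

theorem isClosed_graph_restrictLin (φ : Disc → Disc) (hφ : IsHolSelfMap φ) (ι : X →L[ℂ] Hol)
    (hι : Function.Injective ι) (hinv : ∀ x, ∃ y, ι y = compOp φ hφ (ι x)) :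
    IsClosed ((restrictLin φ hφ ι hι hinv).graph : Set (X × X)) := by
  convert isClosed_eq (ι.continuous.comp (continuous_snd (X := X) (Y := X)))
    ((compOp φ hφ).continuous.comp (ι.continuous.comp continuous_fst)) using 1
  ext p
  rw [SetLike.mem_coe, LinearMap.mem_graph_iff]
  have h : ι (restrictLin φ hφ ι hι hinv p.1) = compOp φ hφ (ι p.1) := (hinv p.1).choose_spec
  change p.2 = _ ↔ ι p.2 = compOp φ hφ (ι p.1)
  rw [← h]
  exact hι.eq_iff.symm

variable [CompleteSpace X]

/-- The operator `T = C_φ|_X` on a Banach space `X ↪ Hol(𝔻)` (with continuous injection `ι`)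
which is invariant under `C_φ`: `T x` is the element of `X` with `ι (T x) = C_φ (ι x)`.
It is bounded by the closed graph theorem. -/
def restrictOp (φ : Disc → Disc) (hφ : IsHolSelfMap φ) (ι : X →L[ℂ] Hol)
    (hι : Function.Injective ι) (hinv : ∀ x, ∃ y, ι y = compOp φ hφ (ι x)) : X →L[ℂ] X :=
  ContinuousLinearMap.ofIsClosedGraph (isClosed_graph_restrictLin φ hφ ι hι hinv)

theorem restrictOp_spec (φ : Disc → Disc) (hφ : IsHolSelfMap φ) (ι : X →L[ℂ] Hol)
    (hι : Function.Injective ι) (hinv : ∀ x, ∃ y, ι y = compOp φ hφ (ι x)) (x : X) :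
    ι (restrictOp φ hφ ι hι hinv x) = compOp φ hφ (ι x) :=
  (hinv x).choose_spec

end Restriction

section Spectral

variable {X : Type*} [NormedAddCommGroup X] [NormedSpace ℂ X] [CompleteSpace X]

/-- `μ` is an isolated point of the spectrum `σ(T)`. -/
def IsIsolatedSpec (T : X →L[ℂ] X) (μ : ℂ) : Prop :=
  μ ∈ spectrum ℂ T ∧ ∃ ε > 0, ∀ z ∈ spectrum ℂ T, dist z μ < ε → z = μ

/-- `P` is the spectral projection of `T` associated with the isolated point `μ` of `σ(T)`: the
residue at `μ` of the resolvent `λ ↦ (λ - T)⁻¹`, i.e. `(2πi)⁻¹ ∮_{|λ - μ| = ε} (λ - T)⁻¹ dλ`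
for every radius `ε > 0` such that `σ(T)` has no point other than `μ` in `|λ - μ| ≤ ε`. -/
def IsSpectralProj (T : X →L[ℂ] X) (μ : ℂ) (P : X →L[ℂ] X) : Prop :=
  IsIsolatedSpec T μ ∧ ∀ ε > 0, (∀ z ∈ spectrum ℂ T, dist z μ ≤ ε → z = μ) →
    P = (2 * Real.pi * Complex.I : ℂ)⁻¹ • ∮ z in C(μ, ε), resolvent T z

/-- `μ` is a simple pole: it is an isolated point of `σ(T)`, it is a pole of order one of the
resolvent, and the range of the associated spectral projection is one-dimensional. -/
def IsSimplePole (T : X →L[ℂ] X) (μ : ℂ) : Prop :=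
  IsIsolatedSpec T μ ∧ meromorphicOrderAt (resolvent T) μ = -1 ∧
    ∃ P, IsSpectralProj T μ P ∧ Module.finrank ℂ P.range = 1

end Spectral

end

end HolDisc

section

open Metric Set Filter Topology ComplexConjugate

/-! Every `f` in `Hol` has a formal expansion in powers of `κ`. Since `κ` vanishes to order exactly
one at `α`, the coefficients `c_k(f)` solve a triangular system in the Taylor coefficients at `α`,
and `P_k f = c_k(f) κ ^ k`. Composition with `φ` preserves the order of vanishing at `α`, so it acts
diagonally: `c_k(f ∘ φ) = λ_k c_k(f)` (`IsSchroeder.koenigsCoeff_compOp`).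

The contour integral gives two identities for the spectral projection `P` at `μ`: `P = (T - ν) S`
for each `ν ≠ μ`, and `P - 1 = (T - μ) S` for another operator `S`. Applying `c_k` to the first with
`ν = λ_k` gives `c_k ∘ P = 0` whenever `λ_k ≠ μ`. If no `λ_k` equals `μ`, all coefficients of `P x`
vanish, hence `P = 0`, which is impossible at a spectral point. So `μ = λ_n`, for a single `n`; the
second identity gives `c_n ∘ P = c_n`, and therefore `P x = c_n(x) κ ^ n = P_n x`. The argument is
algebraic in the `c_k`; their continuity on `X` plays no role. The range of `P` is then an
eigenline, which makes the pole simple. The existence of `κ` is Koenigs' theorem, proved by an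
infinite product after moving `α` to `0`. -/

theorem ContinuousLinearMap.circleIntegral_comp_comm {E F : Type*} [NormedAddCommGroup E]
    [NormedSpace ℂ E] [CompleteSpace E] [NormedAddCommGroup F] [NormedSpace ℂ F] [CompleteSpace F]
    (L : E →L[ℂ] F) {f : ℂ → E} {c : ℂ} {R : ℝ} (hf : CircleIntegrable f c R) :
    ∮ z in C(c, R), L (f z) = L (∮ z in C(c, R), f z) := by
  simp only [circleIntegral]
  rw [← L.intervalIntegral_comp_comm hf.out]
  simp

/-! ### Contour integrals of the resolvent in a Banach algebra -/

section BanachAlgebra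

variable {A : Type*} [NormedRing A] [NormedAlgebra ℂ A]

/-- Write `a - ν = (z - ν) - (z - a)`; the resolvent cancels the second term. Integrated over a
circle, this produces both identities for the spectral projection. -/
theorem sub_mul_smul_resolvent {a : A} {z ν : ℂ} (hz : z ∈ resolventSet ℂ a) (hν : z ≠ ν) :
    (a - algebraMap ℂ A ν) * ((z - ν)⁻¹ • resolvent a z) =
      resolvent a z - (z - ν)⁻¹ • (1 : A) := by
  have h1 : (algebraMap ℂ A z - a) * resolvent a z = 1 := Ring.mul_inverse_cancel _ hz
  have h2 : a - algebraMap ℂ A ν = algebraMap ℂ A (z - ν) - (algebraMap ℂ A z - a) := by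
    rw [map_sub]; abel
  rw [mul_smul_comm, h2, sub_mul, h1, ← Algebra.smul_def, smul_sub, smul_smul,
    inv_mul_cancel₀ (sub_ne_zero.2 hν), one_smul]

theorem smul_resolvent_mul_sub {a : A} {z ν : ℂ} (hz : z ∈ resolventSet ℂ a) (hν : z ≠ ν) :
    ((z - ν)⁻¹ • resolvent a z) * (a - algebraMap ℂ A ν) =
      resolvent a z - (z - ν)⁻¹ • (1 : A) := by
  have h1 : resolvent a z * (algebraMap ℂ A z - a) = 1 := Ring.inverse_mul_cancel _ hz
  have h2 : a - algebraMap ℂ A ν = algebraMap ℂ A (z - ν) - (algebraMap ℂ A z - a) := by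
    rw [map_sub]; abel
  rw [smul_mul_assoc, h2, mul_sub, h1, ← Algebra.commutes, ← Algebra.smul_def, smul_sub, smul_smul,
    inv_mul_cancel₀ (sub_ne_zero.2 hν), one_smul]

variable [CompleteSpace A]

theorem continuousOn_resolvent (a : A) : ContinuousOn (resolvent a) (resolventSet ℂ a) :=
  fun _ hz => (spectrum.hasDerivAt_resolvent_const_left hz).continuousAt.continuousWithinAt

variable {a : A} {c ν : ℂ} {R : ℝ}

theorem circleIntegrable_inv_smul_resolvent (hR : 0 ≤ R) (hs : sphere c R ⊆ resolventSet ℂ a)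
    (hν : ν ∉ sphere c R) : CircleIntegrable (fun z => (z - ν)⁻¹ • resolvent a z) c R := by
  refine ContinuousOn.circleIntegrable hR (ContinuousOn.smul (ContinuousOn.inv₀ (by fun_prop) ?_)
    ((continuousOn_resolvent a).mono hs))
  rintro z hz h
  exact hν (sub_eq_zero.1 h ▸ hz)

theorem circleIntegral_resolvent_sub (hR : 0 ≤ R) (hs : sphere c R ⊆ resolventSet ℂ a)
    (hν : ν ∉ sphere c R) :
    ∮ z in C(c, R), (resolvent a z - (z - ν)⁻¹ • (1 : A)) =
      (∮ z in C(c, R), resolvent a z) - (∮ z in C(c, R), (z - ν)⁻¹) • (1 : A) := by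
  have hc : ContinuousOn (fun z : ℂ => (z - ν)⁻¹) (sphere c R) := by
    refine ContinuousOn.inv₀ (by fun_prop) ?_
    rintro z hz h
    exact hν (sub_eq_zero.1 h ▸ hz)
  have hint : CircleIntegrable (fun z : ℂ => (z - ν)⁻¹ • (1 : A)) c R :=
    (hc.smul continuousOn_const).circleIntegrable hR
  rw [circleIntegral.integral_sub (((continuousOn_resolvent a).mono hs).circleIntegrable hR) hint,
    circleIntegral.integral_smul_const]

theorem sub_mul_circleIntegral_resolvent (hR : 0 ≤ R) (hs : sphere c R ⊆ resolventSet ℂ a)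
    (hν : ν ∉ sphere c R) :
    (a - algebraMap ℂ A ν) * ∮ z in C(c, R), (z - ν)⁻¹ • resolvent a z =
      (∮ z in C(c, R), resolvent a z) - (∮ z in C(c, R), (z - ν)⁻¹) • (1 : A) := by
  rw [← circleIntegral_resolvent_sub hR hs hν]
  refine ((ContinuousLinearMap.mul ℂ A (a - algebraMap ℂ A ν)).circleIntegral_comp_comm
    (circleIntegrable_inv_smul_resolvent hR hs hν)).symm.trans
      (circleIntegral.integral_congr hR fun z hz => ?_)
  exact sub_mul_smul_resolvent (hs hz) fun h => hν (h ▸ hz)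

theorem circleIntegral_resolvent_mul_sub (hR : 0 ≤ R) (hs : sphere c R ⊆ resolventSet ℂ a)
    (hν : ν ∉ sphere c R) :
    (∮ z in C(c, R), (z - ν)⁻¹ • resolvent a z) * (a - algebraMap ℂ A ν) =
      (∮ z in C(c, R), resolvent a z) - (∮ z in C(c, R), (z - ν)⁻¹) • (1 : A) := by
  rw [← circleIntegral_resolvent_sub hR hs hν]
  refine (((ContinuousLinearMap.mul ℂ A).flip (a - algebraMap ℂ A ν)).circleIntegral_comp_comm
    (circleIntegrable_inv_smul_resolvent hR hs hν)).symm.trans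
      (circleIntegral.integral_congr hR fun z hz => ?_)
  exact smul_resolvent_mul_sub (hs hz) fun h => hν (h ▸ hz)

theorem circleIntegral_inv_eq_zero_of_lt_dist (hR : 0 ≤ R) (hν : R < dist ν c) :
    ∮ z in C(c, R), (z - ν)⁻¹ = 0 := by
  have hne : ∀ z ∈ closedBall c R, z - ν ≠ 0 := by
    rintro z hz h
    rw [sub_eq_zero.1 h, mem_closedBall] at hz
    exact hν.not_ge hz
  refine Complex.circleIntegral_eq_zero_of_differentiable_on_off_countable hR countable_empty
    (ContinuousOn.inv₀ (by fun_prop) hne) fun z hz => ?_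
  exact DifferentiableAt.inv (by fun_prop) (hne z (ball_subset_closedBall hz.1))

theorem circleIntegral_resolvent_eq_of_le {r : ℝ} (hr : 0 < r) (hle : r ≤ R)
    (hs : ∀ z ∈ spectrum ℂ a, dist z c ≤ R → z = c) :
    ∮ z in C(c, R), resolvent a z = ∮ z in C(c, r), resolvent a z := by
  have hmem : ∀ z, dist z c ≤ R → z ≠ c → z ∈ resolventSet ℂ a := fun z hz hzc => by
    by_contra h
    exact hzc (hs z h hz)
  refine Complex.circleIntegral_eq_of_differentiable_on_annulus_off_countable hr hle
    countable_empty ((continuousOn_resolvent a).mono fun z hz => hmem z hz.1 ?_) fun z hz =>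
      (spectrum.hasDerivAt_resolvent_const_left (hmem z hz.1.1.le ?_)).differentiableAt
  · rintro rfl
    exact hz.2 (mem_ball_self hr)
  · rintro rfl
    exact hz.1.2 (mem_closedBall_self hr.le)

/-- The hypotheses give `(z - a)(p + (z - μ)s) = (z - μ)(1 + (z - μ)s)`, and the last factor is
invertible near `μ`. So `(z - μ)` times the resolvent extends analytically to `μ`, with value `p`.
-/
theorem meromorphicOrderAt_resolvent_eq_neg_one {μ : ℂ} {p s : A} (hp : p ≠ 0)
    (hap : (a - algebraMap ℂ A μ) * p = 0) (has : (a - algebraMap ℂ A μ) * s = p - 1)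
    (hμ : ∀ᶠ z in 𝓝[≠] μ, z ∈ resolventSet ℂ a) : meromorphicOrderAt (resolvent a) μ = -1 := by
  set d : ℂ → A := fun z => 1 + (z - μ) • s with hd
  have hdan : AnalyticAt ℂ d μ := by fun_prop
  have hdμ : d μ = ((1 : Aˣ) : A) := by simp [hd]
  have hinv : AnalyticAt ℂ (fun z => Ring.inverse (d z)) μ := by
    have h2 : AnalyticAt ℂ (Ring.inverse : A → A) ((1 : Aˣ) : A) := analyticAt_inverse _
    rw [← hdμ] at h2
    exact h2.comp hdan
  set g : ℂ → A := fun z => (p + (z - μ) • s) * Ring.inverse (d z) with hg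
  have hgan : AnalyticAt ℂ g μ := AnalyticAt.mul (by fun_prop) hinv
  have hunit : ∀ᶠ z in 𝓝[≠] μ, IsUnit (d z) := by
    have : ∀ᶠ x in 𝓝 (d μ), IsUnit x := by
      rw [hdμ]; exact Units.nhds _
    exact (hdan.continuousAt.eventually this).filter_mono nhdsWithin_le_nhds
  have heq : ∀ᶠ z in 𝓝[≠] μ, resolvent a z = (z - μ) ^ (-1 : ℤ) • g z := by
    filter_upwards [hμ, hunit, self_mem_nhdsWithin] with z hz hu hne
    have hne' : z - μ ≠ 0 := sub_ne_zero.2 hne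
    have hz1 : resolvent a z * (algebraMap ℂ A z - a) = 1 := Ring.inverse_mul_cancel _ hz
    have hz2 : algebraMap ℂ A z - a = algebraMap ℂ A (z - μ) - (a - algebraMap ℂ A μ) := by
      rw [map_sub]; abel
    have h1 : (algebraMap ℂ A z - a) * (p + (z - μ) • s) = (z - μ) • d z := by
      rw [hz2, sub_mul, mul_add (a - _) p, hap, mul_smul_comm, has, ← Algebra.smul_def]
      simp only [hd, smul_add, smul_sub]
      abel
    have h2 : p + (z - μ) • s = (z - μ) • (resolvent a z * d z) := by
      rw [← one_mul (p + (z - μ) • s), ← hz1, mul_assoc, h1, mul_smul_comm]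
    simp only [hg, zpow_neg_one]
    rw [h2, smul_mul_assoc, smul_smul, inv_mul_cancel₀ hne', one_smul, mul_assoc,
      Ring.mul_inverse_cancel _ hu, mul_one]
  have hmer : MeromorphicAt (resolvent a) μ := by
    have h : MeromorphicAt (fun z => (z - μ) ^ (-1 : ℤ) • g z) μ := by
      have := hgan.meromorphicAt
      fun_prop
    exact h.congr (heq.mono fun z hz => hz.symm)
  refine (meromorphicOrderAt_eq_int_iff (n := -1) hmer).2 ⟨g, hgan, ?_, heq⟩
  simpa [hg, hd] using hp

end BanachAlgebra

/-! ### Spectral projections at isolated points of the spectrum -/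

namespace HolDisc

variable {X : Type*} [NormedAddCommGroup X] [NormedSpace ℂ X]
  {T : X →L[ℂ] X} {μ : ℂ}

theorem IsIsolatedSpec.eventually_mem_resolventSet (h : IsIsolatedSpec T μ) :
    ∀ᶠ z in 𝓝[≠] μ, z ∈ resolventSet ℂ T := by
  obtain ⟨-, ε, hε, h⟩ := h
  filter_upwards [nhdsWithin_le_nhds (ball_mem_nhds μ hε), self_mem_nhdsWithin] with z hz hne
  by_contra hzs
  exact hne (h z hzs hz)

theorem IsIsolatedSpec.exists_radius (h : IsIsolatedSpec T μ) {δ : ℝ} (hδ : 0 < δ) :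
    ∃ ε > 0, ε < δ ∧ ∀ z ∈ spectrum ℂ T, dist z μ ≤ ε → z = μ := by
  obtain ⟨-, ε, hε, h⟩ := h
  have hm : 0 < min ε δ := lt_min hε hδ
  refine ⟨min ε δ / 2, half_pos hm, (half_lt_self hm).trans_le (min_le_right _ _),
    fun z hz hd => h z hz (hd.trans_lt ((half_lt_self hm).trans_le (min_le_left _ _)))⟩

theorem sphere_subset_resolventSet {ε : ℝ} (hε : 0 < ε)
    (h : ∀ z ∈ spectrum ℂ T, dist z μ ≤ ε → z = μ) : sphere μ ε ⊆ resolventSet ℂ T := by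
  intro z hz
  by_contra hzs
  have := h z hzs (mem_sphere.1 hz).le
  rw [this, mem_sphere, dist_self] at hz
  exact hε.ne hz

variable [CompleteSpace X]

theorem IsIsolatedSpec.exists_isSpectralProj (h : IsIsolatedSpec T μ) :
    ∃ P, IsSpectralProj T μ P := by
  obtain ⟨ε₀, hε₀, -, h₀⟩ := h.exists_radius one_pos
  refine ⟨(2 * Real.pi * Complex.I : ℂ)⁻¹ • ∮ z in C(μ, ε₀), resolvent T z, h,
    fun ε hε hs => ?_⟩
  congr 1
  rcases le_total ε ε₀ with hle | hle
  · exact circleIntegral_resolvent_eq_of_le hε hle h₀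
  · exact (circleIntegral_resolvent_eq_of_le hε₀ hle hs).symm

variable {P : X →L[ℂ] X}

/-- For `ν ≠ μ` the range of the spectral projection at `μ` is contained in that of `T - ν`. -/
theorem IsSpectralProj.exists_eq_sub_mul (h : IsSpectralProj T μ P) {ν : ℂ} (hν : ν ≠ μ) :
    ∃ S : X →L[ℂ] X, P = (T - algebraMap ℂ (X →L[ℂ] X) ν) * S := by
  obtain ⟨ε, hε, hεν, hs⟩ := h.1.exists_radius (dist_pos.2 hν)
  have hsph : ν ∉ sphere μ ε := fun h' => hεν.ne' (mem_sphere.1 h')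
  have key := sub_mul_circleIntegral_resolvent hε.le (sphere_subset_resolventSet hε hs) hsph
  rw [circleIntegral_inv_eq_zero_of_lt_dist hε.le hεν, zero_smul, sub_zero] at key
  refine ⟨(2 * Real.pi * Complex.I : ℂ)⁻¹ • ∮ z in C(μ, ε), (z - ν)⁻¹ • resolvent T z, ?_⟩
  rw [mul_smul_comm, key, h.2 ε hε hs]

/-- Here the scalar kernel `(z - μ)⁻¹` is centred in the contour, so its integral `2πi` contributes
the `-1`. -/
theorem IsSpectralProj.exists_sub_mul_eq (h : IsSpectralProj T μ P) :
    ∃ S : X →L[ℂ] X, (T - algebraMap ℂ (X →L[ℂ] X) μ) * S = P - 1 ∧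
      S * (T - algebraMap ℂ (X →L[ℂ] X) μ) = P - 1 := by
  obtain ⟨ε, hε, -, hs⟩ := h.1.exists_radius one_pos
  have hsph : μ ∉ sphere μ ε := by simpa using hε.ne
  have h1 := sub_mul_circleIntegral_resolvent hε.le (sphere_subset_resolventSet hε hs) hsph
  have h2 := circleIntegral_resolvent_mul_sub hε.le (sphere_subset_resolventSet hε hs) hsph
  rw [circleIntegral.integral_sub_center_inv μ hε.ne'] at h1 h2
  refine ⟨(2 * Real.pi * Complex.I : ℂ)⁻¹ • ∮ z in C(μ, ε), (z - μ)⁻¹ • resolvent T z, ?_, ?_⟩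
  · rw [mul_smul_comm, h1, h.2 ε hε hs, smul_sub, smul_smul,
      inv_mul_cancel₀ Complex.two_pi_I_ne_zero, one_smul]
  · rw [smul_mul_assoc, h2, h.2 ε hε hs, smul_sub, smul_smul,
      inv_mul_cancel₀ Complex.two_pi_I_ne_zero, one_smul]

/-- If `P = 0`, the operator `S` of `exists_sub_mul_eq` is a two-sided inverse of `μ - T`. -/
theorem IsSpectralProj.ne_zero (h : IsSpectralProj T μ P) : P ≠ 0 := by
  rintro rfl
  obtain ⟨S, h1, h2⟩ := h.exists_sub_mul_eq
  rw [zero_sub] at h1 h2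
  have hu : IsUnit (algebraMap ℂ (X →L[ℂ] X) μ - T) :=
    ⟨⟨_, S, by rw [← neg_sub, neg_mul, h1, neg_neg], by rw [← neg_sub, mul_neg, h2, neg_neg]⟩, rfl⟩
  exact h.1.1 hu

/-- If the spectral projection at `μ` has rank one and maps into the eigenspace of `μ`, then `μ` is
a simple pole. -/
theorem IsSpectralProj.isSimplePole (h : IsSpectralProj T μ P)
    (hP : (T - algebraMap ℂ (X →L[ℂ] X) μ) * P = 0) (hr : Module.finrank ℂ P.range = 1) :
    IsSimplePole T μ := by
  obtain ⟨S, h1, -⟩ := h.exists_sub_mul_eq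
  exact ⟨h.1, meromorphicOrderAt_resolvent_eq_neg_one h.ne_zero hP h1
    h.1.eventually_mem_resolventSet, P, h, hr⟩

end HolDisc

/-! ### Koenigs' linearization at the origin -/

/-- The factors of the infinite product defining the linearization of `f` at its fixed point `0` are
summably close to `1` on compact sets. -/
theorem exists_summable_bound_dslope_iterate {f : ℂ → ℂ} (hf : DifferentiableOn ℂ f (ball 0 1))
    (h0 : f 0 = 0) (hlt : ∀ w ∈ ball (0 : ℂ) 1, ‖dslope f 0 w‖ < 1) (hd : deriv f 0 ≠ 0)
    {K : Set ℂ} (hK : K ⊆ ball 0 1) (hKc : IsCompact K) :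
    ∃ u : ℕ → ℝ, Summable u ∧
      ∀ n, ∀ w ∈ K, ‖dslope f 0 (f^[n] w) / deriv f 0 - 1‖ ≤ u n := by
  have h0mem : ball (0 : ℂ) 1 ∈ 𝓝 (0 : ℂ) := ball_mem_nhds _ one_pos
  obtain ⟨ρ, hρ0, hρ1, hKρ⟩ : ∃ ρ : ℝ, 0 ≤ ρ ∧ ρ < 1 ∧ K ⊆ closedBall 0 ρ := by
    rcases K.eq_empty_or_nonempty with rfl | hne
    · exact ⟨0, le_rfl, one_pos, empty_subset _⟩
    · obtain ⟨w, hw, hmax⟩ := hKc.exists_isMaxOn hne (f := fun z => ‖z‖) (by fun_prop)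
      exact ⟨‖w‖, norm_nonneg _, by simpa using hK hw, fun z hz => by simpa using hmax hz⟩
  have hsub : closedBall (0 : ℂ) ρ ⊆ ball 0 1 := closedBall_subset_ball hρ1
  have hg : DifferentiableOn ℂ (dslope f 0) (ball 0 1) :=
    (Complex.differentiableOn_dslope h0mem).2 hf
  have hg' : DifferentiableOn ℂ (dslope (dslope f 0) 0) (ball 0 1) :=
    (Complex.differentiableOn_dslope h0mem).2 hg
  have hcpt : IsCompact (closedBall (0 : ℂ) ρ) := isCompact_closedBall _ _
  have hne : (closedBall (0 : ℂ) ρ).Nonempty := ⟨0, mem_closedBall_self hρ0⟩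
  -- The first maximum `q < 1` is a contraction rate, so iterates decay like `q ^ n`. The second,
  -- `M`, is a Lipschitz constant at `0` for `dslope f 0`, which turns this decay into closeness of
  -- the factors to `1`.
  obtain ⟨w₁, hw₁, hq⟩ := hcpt.exists_isMaxOn hne (f := fun z => ‖dslope f 0 z‖)
    (hg.continuousOn.mono hsub).norm
  obtain ⟨w₂, hw₂, hM⟩ := hcpt.exists_isMaxOn hne (f := fun z => ‖dslope (dslope f 0) 0 z‖)
    (hg'.continuousOn.mono hsub).norm
  set q := ‖dslope f 0 w₁‖ with hqdef
  set M := ‖dslope (dslope f 0) 0 w₂‖ with hMdef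
  have hq0 : 0 ≤ q := norm_nonneg _
  have hM0 : 0 ≤ M := norm_nonneg _
  have hq1 : q < 1 := hlt _ (hsub hw₁)
  have hstep : ∀ w ∈ closedBall (0 : ℂ) ρ, ‖f w‖ ≤ q * ‖w‖ := fun w hw => by
    have h := sub_smul_dslope f 0 w
    rw [h0, sub_zero, sub_zero] at h
    rw [← h, norm_smul, mul_comm]
    exact mul_le_mul_of_nonneg_right (hq hw) (norm_nonneg _)
  have hiter : ∀ n, ∀ w ∈ closedBall (0 : ℂ) ρ, ‖f^[n] w‖ ≤ q ^ n * ρ := by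
    intro n w hw
    induction n with
    | zero => simpa using hw
    | succ n ih =>
      rw [Function.iterate_succ_apply']
      have hmem : f^[n] w ∈ closedBall (0 : ℂ) ρ := by
        rw [mem_closedBall_zero_iff]
        exact ih.trans (mul_le_of_le_one_left hρ0 (pow_le_one₀ hq0 hq1.le))
      calc ‖f (f^[n] w)‖ ≤ q * ‖f^[n] w‖ := hstep _ hmem
        _ ≤ q * (q ^ n * ρ) := mul_le_mul_of_nonneg_left ih hq0
        _ = q ^ (n + 1) * ρ := by ring
  refine ⟨fun n => q ^ n * (ρ * M / ‖deriv f 0‖),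
    (summable_geometric_of_lt_one hq0 hq1).mul_right _, fun n w hw => ?_⟩
  have hle := hiter n w (hKρ hw)
  have hmem : f^[n] w ∈ closedBall (0 : ℂ) ρ := by
    rw [mem_closedBall_zero_iff]
    exact hle.trans (mul_le_of_le_one_left hρ0 (pow_le_one₀ hq0 hq1.le))
  have h := sub_smul_dslope (dslope f 0) 0 (f^[n] w)
  rw [sub_zero, dslope_same] at h
  rw [div_sub_one hd, ← h, norm_div, norm_smul]
  simp only [← mul_div_assoc, ← mul_assoc]
  gcongr
  exact hM hmem

/-- **Koenigs' linearization theorem** for a fixed point at the origin. -/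
theorem exists_linearization {f : ℂ → ℂ} (hf : DifferentiableOn ℂ f (ball 0 1))
    (hmaps : MapsTo f (ball 0 1) (ball 0 1)) (h0 : f 0 = 0)
    (hlt : ∀ w ∈ ball (0 : ℂ) 1, ‖dslope f 0 w‖ < 1) (hd : deriv f 0 ≠ 0) :
    ∃ k : ℂ → ℂ, DifferentiableOn ℂ k (ball 0 1) ∧
      (∀ w ∈ ball (0 : ℂ) 1, k (f w) = deriv f 0 * k w) ∧ deriv k 0 = 1 := by
  have h0mem : ball (0 : ℂ) 1 ∈ 𝓝 (0 : ℂ) := ball_mem_nhds _ one_pos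
  have hg : DifferentiableOn ℂ (dslope f 0) (ball 0 1) :=
    (Complex.differentiableOn_dslope h0mem).2 hf
  have hit : ∀ n, DifferentiableOn ℂ f^[n] (ball 0 1) := fun n => hf.iterate hmaps n
  set t : ℕ → ℂ → ℂ := fun n w => dslope f 0 (f^[n] w) / deriv f 0 - 1 with ht
  have htd : ∀ n, DifferentiableOn ℂ (t n) (ball 0 1) := fun n =>
    ((hg.comp (hit n) (hmaps.iterate n)).div_const _).sub_const _
  have hprod : HasProdLocallyUniformlyOn (fun n w => 1 + t n w) (fun w => ∏' n, (1 + t n w))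
      (ball 0 1) := by
    refine hasProdLocallyUniformlyOn_of_forall_compact isOpen_ball fun K hK hKc => ?_
    obtain ⟨u, hu, hb⟩ := exists_summable_bound_dslope_iterate hf h0 hlt hd hK hKc
    exact hu.hasProdUniformlyOn_nat_one_add hKc (.of_forall hb)
      fun n => (htd n).continuousOn.mono hK
  have hdiff : DifferentiableOn ℂ (fun w => ∏' n, (1 + t n w)) (ball 0 1) :=
    hprod.differentiableOn (.of_forall fun s => by
      simpa [Finset.prod_fn] using
        DifferentiableOn.finsetProd fun n _ => (htd n).const_add 1) isOpen_ball
  -- The partial products telescope to `f^[n] w / f'(0) ^ n` (for `w ≠ 0`, as long as no iterate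
  -- hits `0`), the classical Koenigs approximants. Replacing `w` by `f w` shifts the factors by
  -- one.
  refine ⟨fun w => w * ∏' n, (1 + t n w), differentiableOn_id.mul hdiff, fun w hw => ?_, ?_⟩
  · have hshift : ∀ n, t n (f w) = t (n + 1) w := fun n => by
      simp only [ht, Function.iterate_succ_apply]
    have hm : Multipliable fun n => 1 + t (n + 1) w :=
      (hprod.hasProd (hmaps hw)).multipliable.congr fun n => by rw [hshift]
    have h1 : deriv f 0 * (1 + t 0 w) = dslope f 0 w := by
      simp only [ht, Function.iterate_zero, id]
      rw [add_sub_cancel, mul_div_cancel₀ _ hd]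
    have h2 : w * dslope f 0 w = f w := by
      simpa [h0] using sub_smul_dslope f 0 w
    have h3 : ∏' n, (1 + t n w) = (1 + t 0 w) * ∏' n, (1 + t (n + 1) w) :=
      tprod_eq_zero_mul' (f := fun n => 1 + t n w) hm
    simp only [hshift]
    rw [h3, ← h2, ← h1]
    ring
  · have hfix : ∀ n, f^[n] 0 = 0 := fun n => Function.iterate_fixed h0 n
    have h1 : ∏' n, (1 + t n 0) = 1 := by
      simp [ht, hfix, div_self hd]
    have h2 := (hasDerivAt_id (0 : ℂ)).mul (hdiff.differentiableAt h0mem).hasDerivAt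
    refine h2.deriv.trans ?_
    simp [h1]

/-! ### Moving the fixed point to the origin by a disc automorphism -/

namespace HolDisc

theorem zeroExt_eventuallyEq {f : Disc → ℂ} {F : ℂ → ℂ} (h : ∀ z : Disc, f z = F z) (z : Disc) :
    zeroExt f =ᶠ[𝓝 (z : ℂ)] F := by
  filter_upwards [isOpen_ball.mem_nhds z.2] with w hw
  exact (zeroExt_coe f ⟨w, hw⟩).trans (h ⟨w, hw⟩)

theorem IsHol.differentiableAt {f : Disc → ℂ} (hf : IsHol f) (z : Disc) :
    DifferentiableAt ℂ (zeroExt f) z :=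
  DifferentiableOn.differentiableAt hf (isOpen_ball.mem_nhds z.2)

theorem zeroExt_comp_eventuallyEq (f : Disc → ℂ) (ψ : Disc → Disc) (z : Disc) :
    zeroExt (f ∘ ψ) =ᶠ[𝓝 (z : ℂ)] zeroExt f ∘ zeroExt fun w => (ψ w : ℂ) := by
  filter_upwards [isOpen_ball.mem_nhds z.2] with w hw
  have h1 := zeroExt_coe (f ∘ ψ) ⟨w, hw⟩
  have h2 := zeroExt_coe (fun w => (ψ w : ℂ)) ⟨w, hw⟩
  simp only at h1 h2
  rw [h1, Function.comp_apply, Function.comp_apply, h2, zeroExt_coe]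

theorem derivAt_one_comp {f : Disc → ℂ} (hf : IsHol f) {ψ : Disc → Disc} (hψ : IsHolSelfMap ψ)
    (z : Disc) :
    derivAt 1 (f ∘ ψ) z = derivAt 1 f (ψ z) * derivAt 1 (fun w => (ψ w : ℂ)) z := by
  simp only [derivAt, iteratedDeriv_one]
  have h := zeroExt_coe (fun w => (ψ w : ℂ)) z
  rw [(zeroExt_comp_eventuallyEq f ψ z).deriv_eq, deriv_comp, h]
  · rw [h]; exact hf.differentiableAt _
  · exact hψ.differentiableAt _

theorem derivAt_one_eq_deriv {f : Disc → ℂ} {F : ℂ → ℂ} (h : ∀ z : Disc, f z = F z) (z : Disc) :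
    derivAt 1 f z = deriv F z := by
  rw [derivAt, iteratedDeriv_one, (zeroExt_eventuallyEq h z).deriv_eq]

theorem one_sub_conj_mul_ne_zero (a z : Disc) : 1 - conj (a : ℂ) * z ≠ 0 := by
  intro h
  have ha := mem_ball_zero_iff.1 a.2
  have hz := mem_ball_zero_iff.1 z.2
  have h1 : ‖conj (a : ℂ) * z‖ = 1 := by rw [← sub_eq_zero.1 h, norm_one]
  rw [norm_mul, RCLike.norm_conj] at h1
  nlinarith [norm_nonneg (a : ℂ), norm_nonneg (z : ℂ)]

theorem norm_mobius_lt_one (a z : Disc) : ‖((a : ℂ) - z) / (1 - conj (a : ℂ) * z)‖ < 1 := by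
  have hne := norm_pos_iff.2 (one_sub_conj_mul_ne_zero a z)
  rw [norm_div, div_lt_one hne]
  refine lt_of_pow_lt_pow_left₀ 2 hne.le ?_
  have ha : Complex.normSq a < 1 := by
    rw [Complex.normSq_eq_norm_sq]
    exact pow_lt_one₀ (norm_nonneg _) (mem_ball_zero_iff.1 a.2) two_ne_zero
  have hz : Complex.normSq z < 1 := by
    rw [Complex.normSq_eq_norm_sq]
    exact pow_lt_one₀ (norm_nonneg _) (mem_ball_zero_iff.1 z.2) two_ne_zero
  rw [← Complex.normSq_eq_norm_sq, ← Complex.normSq_eq_norm_sq]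
  have key : Complex.normSq (1 - conj (a : ℂ) * z) - Complex.normSq ((a : ℂ) - z) =
      (1 - Complex.normSq a) * (1 - Complex.normSq z) := by
    simp only [Complex.normSq_apply, Complex.sub_re, Complex.sub_im, Complex.mul_re,
      Complex.mul_im, Complex.conj_re, Complex.conj_im, Complex.one_re, Complex.one_im]
    ring
  nlinarith [mul_pos (sub_pos.2 ha) (sub_pos.2 hz)]

/-- The involutive disc automorphism `z ↦ (a - z) / (1 - conj a * z)` exchanging `0` and `a`. -/
noncomputable def mobius (a : Disc) (z : Disc) : Disc :=
  ⟨((a : ℂ) - z) / (1 - conj (a : ℂ) * z), mem_ball_zero_iff.2 (norm_mobius_lt_one a z)⟩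

theorem isHolSelfMap_mobius (a : Disc) : IsHolSelfMap (mobius a) := by
  refine isHol_of_eqOn (F := fun z => ((a : ℂ) - z) / (1 - conj (a : ℂ) * z)) ?_ fun z => rfl
  exact DifferentiableOn.div (by fun_prop) (by fun_prop)
    fun z hz => one_sub_conj_mul_ne_zero a ⟨z, hz⟩

theorem mobius_mobius (a z : Disc) : mobius a (mobius a z) = z := by
  apply Subtype.ext
  have h1 := one_sub_conj_mul_ne_zero a z
  have h2 := one_sub_conj_mul_ne_zero a (mobius a z)
  have h3 := one_sub_conj_mul_ne_zero a a
  have h4 : (mobius a z : ℂ) * (1 - conj (a : ℂ) * z) = a - z := div_mul_cancel₀ _ h1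
  change ((a : ℂ) - mobius a z) / (1 - conj (a : ℂ) * mobius a z) = z
  rw [div_eq_iff h2]
  refine mul_right_cancel₀ h1 ?_
  linear_combination (-1 + (z : ℂ) * conj (a : ℂ)) * h4

theorem mobius_self (a : Disc) : (mobius a a : ℂ) = 0 := by
  simp [mobius]

theorem mobius_zero (a : Disc) : mobius a ⟨0, mem_ball_self one_pos⟩ = a := by
  apply Subtype.ext
  simp [mobius]

/-- Chain rule for the involution. This cancels the Möbius factors in the derivative of the
conjugated map and fixes the normalization of `κ`. -/
theorem derivAt_mobius_mul (a : Disc) :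
    derivAt 1 (fun z => (mobius a z : ℂ)) ⟨0, mem_ball_self one_pos⟩ *
      derivAt 1 (fun z => (mobius a z : ℂ)) a = 1 := by
  have h := derivAt_one_comp (isHolSelfMap_mobius a) (isHolSelfMap_mobius a) a
  have h1 : mobius a a = ⟨0, mem_ball_self one_pos⟩ := Subtype.ext (mobius_self a)
  rw [h1] at h
  have h2 := derivAt_one_eq_deriv (f := (fun z => (mobius a z : ℂ)) ∘ mobius a) (F := id)
    (fun z => congrArg Subtype.val (mobius_mobius a z)) a
  rw [← h, h2, deriv_id]

/-- The rotation of the disc by a number of modulus one. -/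
noncomputable def rotation (c : ℂ) (hc : ‖c‖ = 1) (z : Disc) : Disc :=
  ⟨c * z, by
    have := z.2
    rw [mem_ball_zero_iff] at this ⊢
    rwa [norm_mul, hc, one_mul]⟩

theorem isHolSelfMap_rotation (c : ℂ) (hc : ‖c‖ = 1) : IsHolSelfMap (rotation c hc) :=
  isHol_of_eqOn (F := fun z => c * z) (by fun_prop) fun _ => rfl

/-- The conjugate of a self-map of the disc by the involution exchanging `0` and `a`. -/
noncomputable def mobiusConj (a : Disc) (φ : Disc → Disc) : Disc → Disc :=
  mobius a ∘ φ ∘ mobius a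

theorem mobiusConj_mobius (a : Disc) (φ : Disc → Disc) (z : Disc) :
    mobiusConj a φ (mobius a z) = mobius a (φ z) := by
  simp [mobiusConj, mobius_mobius]

theorem IsHolSelfMap.comp {φ ψ : Disc → Disc} (hφ : IsHolSelfMap φ) (hψ : IsHolSelfMap ψ) :
    IsHolSelfMap (φ ∘ ψ) :=
  isHol_comp hψ hφ

theorem IsHolSelfMap.mobiusConj {φ : Disc → Disc} (hφ : IsHolSelfMap φ) (a : Disc) :
    IsHolSelfMap (mobiusConj a φ) :=
  (isHolSelfMap_mobius a).comp (hφ.comp (isHolSelfMap_mobius a))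

theorem mapsTo_zeroExt (ψ : Disc → Disc) :
    MapsTo (zeroExt fun w => (ψ w : ℂ)) (ball 0 1) (ball 0 1) := fun w hw => by
  have h := zeroExt_coe (fun w => (ψ w : ℂ)) ⟨w, hw⟩
  simp only at h
  rw [h]
  exact (ψ ⟨w, hw⟩).2

variable {φ : Disc → Disc} {α : Disc}

theorem mobiusConj_zero (hfix : φ α = α) :
    zeroExt (fun w => (mobiusConj α φ w : ℂ)) 0 = 0 := by
  have h := zeroExt_coe (fun w => (mobiusConj α φ w : ℂ)) ⟨0, mem_ball_self one_pos⟩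
  simp only at h
  rw [h]
  simp [mobiusConj, mobius_zero, hfix, mobius_self]

theorem deriv_mobiusConj (hφ : IsHolSelfMap φ) (hfix : φ α = α) :
    deriv (zeroExt fun w => (mobiusConj α φ w : ℂ)) 0 = derivAt 1 (fun w => (φ w : ℂ)) α := by
  have h : derivAt 1 (fun w => (mobiusConj α φ w : ℂ)) ⟨0, mem_ball_self one_pos⟩ =
      derivAt 1 (fun w => (φ w : ℂ)) α := by
    have e1 := derivAt_one_comp (isHolSelfMap_mobius α) (hφ.comp (isHolSelfMap_mobius α))
      ⟨0, mem_ball_self one_pos⟩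
    have e2 := derivAt_one_comp hφ (isHolSelfMap_mobius α) ⟨0, mem_ball_self one_pos⟩
    rw [mobius_zero] at e2
    rw [Function.comp_apply, mobius_zero, hfix] at e1
    refine e1.trans ?_
    change _ * derivAt 1 ((fun w => (φ w : ℂ)) ∘ mobius α) _ = _
    rw [e2]
    linear_combination derivAt 1 (fun w => (φ w : ℂ)) α * derivAt_mobius_mul α
  rwa [derivAt, iteratedDeriv_one] at h

theorem isAut_of_mobiusConj_eq_rotation (hφ : IsHolSelfMap φ) {c : ℂ} (hc : ‖c‖ = 1)
    (h : ∀ w, mobiusConj α φ w = rotation c hc w) : IsAut φ := by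
  have hc' : ‖c⁻¹‖ = 1 := by rw [norm_inv, hc, inv_one]
  have hc0 : c ≠ 0 := norm_ne_zero_iff.1 (hc ▸ one_ne_zero)
  have hφz : ∀ z, φ z = mobius α (rotation c hc (mobius α z)) := fun z => by
    rw [← h, mobiusConj_mobius, mobius_mobius]
  refine ⟨hφ, mobiusConj α (rotation c⁻¹ hc'), (isHolSelfMap_rotation _ _).mobiusConj α,
    fun z => ?_, fun z => ?_⟩
  · have : rotation c⁻¹ hc' (rotation c hc (mobius α z)) = mobius α z :=
      Subtype.ext (inv_mul_cancel_left₀ hc0 _)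
    rw [hφz, mobiusConj_mobius, this, mobius_mobius]
  · have : rotation c hc (rotation c⁻¹ hc' (mobius α z)) = mobius α z :=
      Subtype.ext (mul_inv_cancel_left₀ hc0 _)
    rw [hφz]
    simp only [mobiusConj, Function.comp_apply]
    rw [mobius_mobius, this, mobius_mobius]

/-- The strict form of the Schwarz lemma for a Schröder map. -/
theorem IsSchroeder.norm_dslope_lt_one (h : IsSchroeder φ α) {w : ℂ} (hw : w ∈ ball (0 : ℂ) 1) :
    ‖dslope (zeroExt fun w => (mobiusConj α φ w : ℂ)) 0 w‖ < 1 := by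
  have h0 := mobiusConj_zero h.fixed
  have hd : DifferentiableOn ℂ (zeroExt fun w => (mobiusConj α φ w : ℂ)) (ball 0 1) :=
    h.hol.mobiusConj α
  have hm : MapsTo (zeroExt fun w => (mobiusConj α φ w : ℂ)) (ball 0 1)
      (closedBall (zeroExt (fun w => (mobiusConj α φ w : ℂ)) 0) 1) := by
    rw [h0]
    exact (mapsTo_zeroExt _).mono_right ball_subset_closedBall
  have hle := Complex.norm_dslope_le_div_of_mapsTo_ball hd hm hw
  rw [div_one] at hle
  -- Equality in the Schwarz lemma makes the conjugated map a rotation, hence `φ` an automorphism.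
  refine hle.lt_of_ne fun heq => h.not_aut ?_
  obtain ⟨c, hc, hEq⟩ := Complex.affine_of_mapsTo_ball_of_exists_norm_dslope_eq_div' hd hm
    ⟨w, hw, by rw [heq, div_one]⟩
  rw [div_one] at hc
  refine isAut_of_mobiusConj_eq_rotation (α := α) h.hol hc fun z => Subtype.ext ?_
  rw [← zeroExt_coe (fun w => (mobiusConj α φ w : ℂ)) z, hEq z.2, h0]
  simp [rotation, mul_comm]

theorem IsSchroeder.norm_derivAt_lt_one (h : IsSchroeder φ α) :
    ‖derivAt 1 (fun w => (φ w : ℂ)) α‖ < 1 := by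
  rw [← deriv_mobiusConj h.hol h.fixed, ← dslope_same]
  exact h.norm_dslope_lt_one (mem_ball_self one_pos)

/-- **Koenigs' theorem**: a Schröder map has a Koenigs eigenfunction. -/
theorem IsSchroeder.exists_isKoenigs (h : IsSchroeder φ α) : ∃ κ, IsKoenigs φ α κ := by
  have hderiv := deriv_mobiusConj h.hol h.fixed
  obtain ⟨k, hk, hkf, hk'⟩ := exists_linearization (h.hol.mobiusConj α) (mapsTo_zeroExt _)
    (mobiusConj_zero h.fixed) (fun w hw => h.norm_dslope_lt_one hw)
    (hderiv ▸ h.deriv_ne_zero)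
  rw [hderiv] at hkf
  set k₀ : Disc → ℂ := fun z => k z with hk₀
  have hk₀hol : IsHol k₀ := isHol_of_eqOn hk fun _ => rfl
  have hhol := isHol_comp (isHolSelfMap_mobius α) hk₀hol
  set κ : Hol := ⟨⟨_, hhol.continuous⟩, hhol⟩ with hκ
  set c := derivAt 1 (fun z => (mobius α z : ℂ)) ⟨0, mem_ball_self one_pos⟩ with hc
  have hκ' : derivAt 1 κ α = derivAt 1 (fun z => (mobius α z : ℂ)) α := by
    have e := derivAt_one_comp hk₀hol (isHolSelfMap_mobius α) α
    have e' : mobius α α = ⟨0, mem_ball_self one_pos⟩ := Subtype.ext (mobius_self α)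
    rw [e', derivAt_one_eq_deriv (F := k) (fun _ => rfl), hk', one_mul] at e
    exact e
  -- As `k'(0) = 1`, the derivative of `k ∘ mobius α` at `α` is that of `mobius α`, whose inverse is
  -- `c`.
  refine ⟨c • κ, fun z => ?_, ?_⟩
  · have e := hkf (mobius α z) (mobius α z).2
    have e' := zeroExt_coe (fun w => (mobiusConj α φ w : ℂ)) (mobius α z)
    simp only [mobiusConj_mobius] at e'
    rw [e'] at e
    change c * k (mobius α (φ z)) = _ * (c * k (mobius α z))
    rw [e]
    ring
  · have e : derivAt 1 (c • κ : Hol) α = c * derivAt 1 κ α := by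
      have hd : DifferentiableAt ℂ (zeroExt κ) α := κ.2.differentiableAt α
      rw [derivAt, derivAt, iteratedDeriv_one, iteratedDeriv_one, ← deriv_const_mul _ hd]
      refine (zeroExt_eventuallyEq (fun z => ?_) α).deriv_eq
      rw [zeroExt_coe]
      rfl
    rw [e, hκ', hc]
    exact derivAt_mobius_mul α

end HolDisc

/-! ### Expansion in powers of Koenigs' eigenfunction -/

/-- One differentiation keeps the shape, with `n + 1` lowered to `n` and `g` replaced by `(n + 1) g
+ (z - z₀) g'`; hence the induction over all `g`. -/
theorem iteratedDeriv_sub_pow_mul_self {g : ℂ → ℂ} {z₀ : ℂ} (n : ℕ) (hg : AnalyticAt ℂ g z₀) :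
    iteratedDeriv n (fun z => (z - z₀) ^ n * g z) z₀ = n.factorial * g z₀ := by
  induction n generalizing g with
  | zero => simp
  | succ n ih =>
    have h : deriv (fun z => (z - z₀) ^ (n + 1) * g z) =ᶠ[𝓝 z₀]
        fun z => (z - z₀) ^ n * ((n + 1) * g z + (z - z₀) * deriv g z) := by
      filter_upwards [hg.eventually_analyticAt] with z hz
      have h1 : HasDerivAt (fun z => (z - z₀) ^ (n + 1)) ((n + 1 : ℕ) * (z - z₀) ^ n * 1) z :=
        ((hasDerivAt_id z).sub_const z₀).fun_pow (n + 1)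
      refine (h1.mul hz.differentiableAt.hasDerivAt).deriv.trans ?_
      push_cast
      ring
    rw [iteratedDeriv_succ', h.iteratedDeriv_eq, ih (by fun_prop), Nat.factorial_succ]
    push_cast
    ring

namespace HolDisc

theorem IsHol.analyticAt {f : Disc → ℂ} (hf : IsHol f) (z : Disc) :
    AnalyticAt ℂ (zeroExt f) z :=
  DifferentiableOn.analyticAt hf (isOpen_ball.mem_nhds z.2)

/-- The `n`-th derivative at `α` as a linear functional on `Hol(𝔻)`. -/
noncomputable def derivFunctional (n : ℕ) (α : Disc) : Hol →ₗ[ℂ] ℂ where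
  toFun f := derivAt n f α
  map_add' f g := by
    have h : zeroExt (f + g : Hol) =ᶠ[𝓝 (α : ℂ)] zeroExt f + zeroExt g :=
      zeroExt_eventuallyEq (fun z => by rw [Pi.add_apply, zeroExt_coe, zeroExt_coe]; rfl) α
    rw [derivAt, h.iteratedDeriv_eq, iteratedDeriv_add (f.2.analyticAt α).contDiffAt
      (g.2.analyticAt α).contDiffAt]
    rfl
  map_smul' c f := by
    have h : zeroExt (c • f : Hol) =ᶠ[𝓝 (α : ℂ)] c • zeroExt f :=
      zeroExt_eventuallyEq (fun z => by rw [Pi.smul_apply, zeroExt_coe]; rfl) α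
    rw [derivAt, h.iteratedDeriv_eq, iteratedDeriv_const_smul_field]
    rfl

theorem derivFunctional_sub (n : ℕ) (α : Disc) (f g : Hol) :
    derivFunctional n α (f - g) = derivFunctional n α f - derivFunctional n α g :=
  map_sub (derivFunctional n α) f g

theorem Hol.sum_sub_smul (s : Finset ℕ) (a b : ℕ → ℂ) (f : ℕ → Hol) :
    ∑ k ∈ s, (a k - b k) • f k = ∑ k ∈ s, a k • f k - ∑ k ∈ s, b k • f k :=
  (Finset.sum_congr rfl fun k _ => sub_smul (a k) (b k) (f k)).trans
    (Finset.sum_sub_distrib (G := Hol) (fun k => a k • f k) fun k => b k • f k)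

theorem le_analyticOrderAt_iff (f : Hol) (α : Disc) (N : ℕ) :
    (N : ℕ∞) ≤ analyticOrderAt (zeroExt f) α ↔ ∀ j < N, derivFunctional j α f = 0 :=
  natCast_le_analyticOrderAt_iff_iteratedDeriv_eq_zero (f.2.analyticAt α)

theorem eq_zero_of_forall_derivFunctional_eq_zero {f : Hol} {α : Disc}
    (h : ∀ j, derivFunctional j α f = 0) : f = 0 := by
  have htop : analyticOrderAt (zeroExt f) α = ⊤ :=
    ENat.eq_top_iff_forall_ge.2 fun N => (le_analyticOrderAt_iff f α N).2 fun j _ => h j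
  have hz := (DifferentiableOn.analyticOnNhd f.2 isOpen_ball
    ).eqOn_zero_of_preconnected_of_eventuallyEq_zero (convex_ball (0 : ℂ) 1).isPreconnected α.2
      (analyticOrderAt_eq_top.1 htop)
  refine Subtype.ext (ContinuousMap.ext fun z => ?_)
  exact (zeroExt_coe f z).symm.trans (hz z.2)

variable {φ : Disc → Disc} {α : Disc}

/-- Since `φ` fixes `α` and `φ'(α) ≠ 0`, composition preserves the order of vanishing at `α`. Thus
`C_φ` maps remainders to remainders. -/
theorem IsSchroeder.derivFunctional_compOp (h : IsSchroeder φ α) {f : Hol} {N : ℕ}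
    (hf : ∀ j < N, derivFunctional j α f = 0) :
    ∀ j < N, derivFunctional j α (compOp φ h.hol f) = 0 := by
  rw [← le_analyticOrderAt_iff] at hf ⊢
  have h1 := zeroExt_coe (fun w => (φ w : ℂ)) α
  have h2 : deriv (zeroExt fun w => (φ w : ℂ)) α ≠ 0 := by
    have := h.deriv_ne_zero
    rwa [derivAt, iteratedDeriv_one] at this
  have h3 : zeroExt (compOp φ h.hol f) =ᶠ[𝓝 (α : ℂ)] zeroExt f ∘ zeroExt fun w => (φ w : ℂ) :=
    zeroExt_comp_eventuallyEq f φ α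
  rw [analyticOrderAt_congr h3,
    analyticOrderAt_comp_of_deriv_ne_zero (IsHol.analyticAt h.hol α) h2, h1, h.fixed]
  exact hf

theorem IsSchroeder.isKoenigs_koenigs (h : IsSchroeder φ α) : IsKoenigs φ α (koenigs φ α) :=
  Classical.epsilon_spec h.exists_isKoenigs

theorem IsSchroeder.koenigs_apply_self (h : IsSchroeder φ α) : koenigs φ α α = 0 := by
  have h1 := h.isKoenigs_koenigs.1 α
  rw [h.fixed] at h1
  have h2 : derivAt 1 (fun w => (φ w : ℂ)) α ≠ 1 := fun h2 => by
    have := h.norm_derivAt_lt_one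
    rw [h2, norm_one] at this
    exact lt_irrefl _ this
  refine (mul_eq_zero.1 (?_ : (derivAt 1 (fun w => (φ w : ℂ)) α - 1) * _ = 0)).resolve_left
    (sub_ne_zero.2 h2)
  linear_combination -h1

theorem zeroExt_koenigs_pow_eventuallyEq (h : IsSchroeder φ α) (n : ℕ) :
    zeroExt (koenigs φ α ^ n : Hol) =ᶠ[𝓝 (α : ℂ)]
      fun z => (z - α) ^ n * dslope (zeroExt (koenigs φ α)) α z ^ n := by
  refine zeroExt_eventuallyEq (fun z => ?_) α
  have h1 := sub_smul_dslope (zeroExt (koenigs φ α)) α z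
  rw [zeroExt_coe, zeroExt_coe, h.koenigs_apply_self, sub_zero, smul_eq_mul] at h1
  rw [← mul_pow, h1]
  rfl

theorem analyticAt_dslope_koenigs (φ : Disc → Disc) (α : Disc) :
    AnalyticAt ℂ (dslope (zeroExt (koenigs φ α)) α) α :=
  ((Complex.differentiableOn_dslope (isOpen_ball.mem_nhds α.2)).2 (koenigs φ α).2).analyticAt
    (isOpen_ball.mem_nhds α.2)

theorem IsSchroeder.derivFunctional_koenigs_pow_self (h : IsSchroeder φ α) (n : ℕ) :
    derivFunctional n α (koenigs φ α ^ n) = n.factorial := by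
  have h1 := h.isKoenigs_koenigs.2
  rw [derivAt, iteratedDeriv_one] at h1
  change iteratedDeriv n _ _ = _
  rw [(zeroExt_koenigs_pow_eventuallyEq h n).iteratedDeriv_eq,
    iteratedDeriv_sub_pow_mul_self n ((analyticAt_dslope_koenigs φ α).fun_pow n), dslope_same, h1,
    one_pow, mul_one]

theorem IsSchroeder.derivFunctional_koenigs_pow_of_lt (h : IsSchroeder φ α) {j n : ℕ}
    (hj : j < n) : derivFunctional j α (koenigs φ α ^ n) = 0 := by
  refine (le_analyticOrderAt_iff _ α n).1 ?_ j hj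
  rw [natCast_le_analyticOrderAt ((koenigs φ α ^ n).2.analyticAt α)]
  exact ⟨_, (analyticAt_dslope_koenigs φ α).fun_pow n, zeroExt_koenigs_pow_eventuallyEq h n⟩

/-- The `n`-th coefficient of `f` in its expansion in powers of Koenigs' eigenfunction. -/
noncomputable def koenigsCoeff (φ : Disc → Disc) (α : Disc) (n : ℕ) (f : Hol) : ℂ :=
  (n.factorial : ℂ)⁻¹ * derivAt n (f - ∑ k : Fin n, koenigsProj φ α k f : Hol) α

theorem koenigsProj_eq (φ : Disc → Disc) (α : Disc) (n : ℕ) (f : Hol) :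
    koenigsProj φ α n f = koenigsCoeff φ α n f • koenigs φ α ^ n := by
  rw [koenigsProj, koenigsCoeff]

/-- The remainder of the expansion of `f` up to order `N` in powers of Koenigs' eigenfunction. -/
noncomputable def koenigsRemainder (φ : Disc → Disc) (α : Disc) (N : ℕ) (f : Hol) : Hol :=
  f - ∑ k ∈ Finset.range N, koenigsCoeff φ α k f • koenigs φ α ^ k

theorem koenigsCoeff_eq (φ : Disc → Disc) (α : Disc) (n : ℕ) (f : Hol) :
    koenigsCoeff φ α n f =
      (n.factorial : ℂ)⁻¹ * derivFunctional n α (koenigsRemainder φ α n f) := by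
  rw [koenigsCoeff, koenigsRemainder, Fin.sum_univ_eq_sum_range fun k => koenigsProj φ α k f]
  simp only [koenigsProj_eq]
  rfl

/-- The coefficient of `κ ^ N` is chosen to kill the `N`-th derivative, and subtracting this term
leaves the lower ones untouched. -/
theorem IsSchroeder.derivFunctional_koenigsRemainder (h : IsSchroeder φ α) (f : Hol) (N : ℕ) :
    ∀ j < N, derivFunctional j α (koenigsRemainder φ α N f) = 0 := by
  induction N with
  | zero => intro j hj; exact absurd hj (Nat.not_lt_zero j)
  | succ N ih =>
    intro j hj
    have hsucc : koenigsRemainder φ α (N + 1) f =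
        koenigsRemainder φ α N f - koenigsCoeff φ α N f • koenigs φ α ^ N := by
      simp only [koenigsRemainder, Finset.sum_range_succ]
      abel
    rw [hsucc, derivFunctional_sub, map_smul, smul_eq_mul]
    rcases (Nat.lt_succ_iff.1 hj).lt_or_eq with hlt | rfl
    · rw [ih j hlt, h.derivFunctional_koenigs_pow_of_lt hlt, mul_zero, sub_zero]
    · have hfac : (j.factorial : ℂ) ≠ 0 := Nat.cast_ne_zero.2 j.factorial_ne_zero
      rw [h.derivFunctional_koenigs_pow_self, koenigsCoeff_eq]
      field_simp
      ring

/-- The system is triangular with diagonal entries `j!`: only `k ≤ j` contribute to the `j`-th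
derivative. -/
theorem IsSchroeder.eq_zero_of_derivFunctional_sum (h : IsSchroeder φ α) {b : ℕ → ℂ} {N : ℕ}
    (hb : ∀ j < N, derivFunctional j α (∑ k ∈ Finset.range N, b k • koenigs φ α ^ k) = 0) :
    ∀ j < N, b j = 0 := by
  intro j
  induction j using Nat.strong_induction_on with
  | _ j ih =>
    intro hj
    have h1 := hb j hj
    rw [map_sum, Finset.sum_eq_single j] at h1
    · rw [map_smul, h.derivFunctional_koenigs_pow_self, smul_eq_mul] at h1
      exact (mul_eq_zero.1 h1).resolve_right (Nat.cast_ne_zero.2 j.factorial_ne_zero)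
    · intro k hk hkj
      rw [map_smul, smul_eq_mul]
      rcases lt_or_gt_of_ne hkj with hlt | hgt
      · rw [ih k hlt (hlt.trans hj), zero_mul]
      · rw [h.derivFunctional_koenigs_pow_of_lt hgt, mul_zero]
    · intro hn
      exact absurd (Finset.mem_range.2 hj) hn

/-- Uniqueness of the coefficients of the expansion in powers of Koenigs' eigenfunction. -/
theorem IsSchroeder.koenigsCoeff_unique (h : IsSchroeder φ α) {f r : Hol} {a : ℕ → ℂ} {N : ℕ}
    (hf : f = ∑ k ∈ Finset.range N, a k • koenigs φ α ^ k + r)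
    (hr : ∀ j < N, derivFunctional j α r = 0) : ∀ j < N, koenigsCoeff φ α j f = a j := by
  intro j hj
  refine sub_eq_zero.1 (h.eq_zero_of_derivFunctional_sum (N := N)
    (b := fun k => koenigsCoeff φ α k f - a k) (fun i hi => ?_) j hj)
  have hs : ∑ k ∈ Finset.range N, (koenigsCoeff φ α k f - a k) • koenigs φ α ^ k =
      r - koenigsRemainder φ α N f := by
    have hr' : r = f - ∑ k ∈ Finset.range N, a k • koenigs φ α ^ k := by
      rw [hf]
      abel
    rw [Hol.sum_sub_smul, koenigsRemainder, hr']
    abel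
  rw [hs, derivFunctional_sub, hr i hi, h.derivFunctional_koenigsRemainder f N i hi, sub_zero]

theorem eq_sum_add_koenigsRemainder (φ : Disc → Disc) (α : Disc) (N : ℕ) (f : Hol) :
    f = ∑ k ∈ Finset.range N, koenigsCoeff φ α k f • koenigs φ α ^ k +
      koenigsRemainder φ α N f := by
  rw [koenigsRemainder]
  abel

theorem IsSchroeder.koenigsCoeff_sub (h : IsSchroeder φ α) (n : ℕ) (f g : Hol) :
    koenigsCoeff φ α n (f - g) = koenigsCoeff φ α n f - koenigsCoeff φ α n g := by
  refine h.koenigsCoeff_unique (a := fun k => koenigsCoeff φ α k f - koenigsCoeff φ α k g)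
    (r := koenigsRemainder φ α (n + 1) f - koenigsRemainder φ α (n + 1) g) ?_
    (fun j hj => ?_) n n.lt_succ_self
  · rw [Hol.sum_sub_smul, koenigsRemainder, koenigsRemainder]
    abel
  · rw [derivFunctional_sub, h.derivFunctional_koenigsRemainder f _ j hj,
      h.derivFunctional_koenigsRemainder g _ j hj, sub_zero]

theorem IsSchroeder.koenigsCoeff_smul (h : IsSchroeder φ α) (n : ℕ) (c : ℂ) (f : Hol) :
    koenigsCoeff φ α n (c • f) = c * koenigsCoeff φ α n f := by
  refine h.koenigsCoeff_unique (a := fun k => c * koenigsCoeff φ α k f)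
    (r := c • koenigsRemainder φ α (n + 1) f) ?_ (fun j hj => ?_) n n.lt_succ_self
  · nth_rewrite 1 [eq_sum_add_koenigsRemainder φ α (n + 1) f]
    simp only [smul_add, Finset.smul_sum, smul_smul]
  · rw [map_smul, h.derivFunctional_koenigsRemainder f _ j hj, smul_zero]

theorem IsSchroeder.compOp_koenigs_pow (h : IsSchroeder φ α) (n : ℕ) :
    compOp φ h.hol (koenigs φ α ^ n) = eigenval φ α n • koenigs φ α ^ n := by
  refine Subtype.ext (ContinuousMap.ext fun z => ?_)
  change koenigs φ α (φ z) ^ n = _ * koenigs φ α z ^ n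
  rw [h.isKoenigs_koenigs.1, mul_pow, eigenval]

/-- Apply `C_φ` termwise to the finite expansion; the result is again an expansion with admissible
remainder, so uniqueness reads off the coefficients. -/
theorem IsSchroeder.koenigsCoeff_compOp (h : IsSchroeder φ α) (n : ℕ) (f : Hol) :
    koenigsCoeff φ α n (compOp φ h.hol f) = eigenval φ α n * koenigsCoeff φ α n f := by
  refine h.koenigsCoeff_unique (a := fun k => eigenval φ α k * koenigsCoeff φ α k f)
    (r := compOp φ h.hol (koenigsRemainder φ α (n + 1) f)) ?_
    (h.derivFunctional_compOp (h.derivFunctional_koenigsRemainder f _)) n n.lt_succ_self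
  nth_rewrite 1 [eq_sum_add_koenigsRemainder φ α (n + 1) f]
  simp only [map_add, map_sum, map_smul, h.compOp_koenigs_pow, smul_smul]
  simp only [mul_comm]

theorem IsSchroeder.eq_koenigsProj_of_koenigsCoeff_eq_zero (h : IsSchroeder φ α) {f : Hol} {n : ℕ}
    (hf : ∀ k ≠ n, koenigsCoeff φ α k f = 0) : f = koenigsProj φ α n f := by
  rw [← sub_eq_zero]
  refine eq_zero_of_forall_derivFunctional_eq_zero (α := α) fun j => ?_
  -- The order `j + n + 1` exceeds both `n`, so that the surviving term is included, and `j`, so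
  -- that the `j`-th derivative vanishes.
  have hr : koenigsRemainder φ α (j + n + 1) f = f - koenigsProj φ α n f := by
    rw [koenigsRemainder, koenigsProj_eq, Finset.sum_eq_single n]
    · intro k _ hk
      rw [hf k hk, zero_smul]
    · intro hn
      exact absurd (Finset.mem_range.2 (by omega)) hn
  rw [← hr]
  exact h.derivFunctional_koenigsRemainder f _ j (by omega)

theorem IsSchroeder.eigenval_injective (h : IsSchroeder φ α) :
    Function.Injective (eigenval φ α) := by
  intro m n hmn
  have h1 := congrArg norm hmn
  simp only [eigenval, norm_pow] at h1
  exact pow_right_injective₀ (norm_pos_iff.2 h.deriv_ne_zero) h.norm_derivAt_lt_one.ne h1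

/-! ### Identification of the spectral projection on `X` -/

section Restriction

variable {X : Type*} [NormedAddCommGroup X] [NormedSpace ℂ X]
  {ι : X →L[ℂ] Hol} {T P : X →L[ℂ] X} {μ : ℂ}

theorem IsSchroeder.koenigsCoeff_sub_algebraMap (h : IsSchroeder φ α)
    (hT : ∀ x, ι (T x) = compOp φ h.hol (ι x)) (k : ℕ) (ν : ℂ) (x : X) :
    koenigsCoeff φ α k (ι ((T - algebraMap ℂ (X →L[ℂ] X) ν) x)) =
      (eigenval φ α k - ν) * koenigsCoeff φ α k (ι x) := by
  have : ι ((T - algebraMap ℂ (X →L[ℂ] X) ν) x) = compOp φ h.hol (ι x) - ν • ι x := by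
    rw [Algebra.algebraMap_eq_smul_one, sub_apply, map_sub, hT]
    simp
  rw [this, h.koenigsCoeff_sub, h.koenigsCoeff_smul, h.koenigsCoeff_compOp, sub_mul]

variable [CompleteSpace X]

theorem IsSchroeder.koenigsCoeff_spectralProj_of_ne (h : IsSchroeder φ α)
    (hT : ∀ x, ι (T x) = compOp φ h.hol (ι x)) (hP : IsSpectralProj T μ P) {k : ℕ}
    (hk : eigenval φ α k ≠ μ) (x : X) : koenigsCoeff φ α k (ι (P x)) = 0 := by
  obtain ⟨S, rfl⟩ := hP.exists_eq_sub_mul hk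
  rw [mul_apply_eq_comp, h.koenigsCoeff_sub_algebraMap hT, sub_self, zero_mul]

/-- The `n`-th coefficient annihilates the range of `T - μ`, which contains that of `P - 1`. -/
theorem IsSchroeder.koenigsCoeff_spectralProj_of_eq (h : IsSchroeder φ α)
    (hT : ∀ x, ι (T x) = compOp φ h.hol (ι x)) (hP : IsSpectralProj T μ P) {n : ℕ}
    (hn : eigenval φ α n = μ) (x : X) :
    koenigsCoeff φ α n (ι (P x)) = koenigsCoeff φ α n (ι x) := by
  obtain ⟨S, hS, -⟩ := hP.exists_sub_mul_eq
  have h1 := h.koenigsCoeff_sub_algebraMap hT n μ (S x)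
  rw [← mul_apply_eq_comp, hS, hn, sub_self, zero_mul, sub_apply, map_sub,
    h.koenigsCoeff_sub] at h1
  exact sub_eq_zero.1 h1

theorem IsSchroeder.exists_eigenval_eq (h : IsSchroeder φ α) (hι : Function.Injective ι)
    (hT : ∀ x, ι (T x) = compOp φ h.hol (ι x)) (hP : IsSpectralProj T μ P) :
    ∃ n, eigenval φ α n = μ := by
  by_contra! hne
  refine hP.ne_zero (ContinuousLinearMap.ext fun x => hι ?_)
  have hc : ∀ k, koenigsCoeff φ α k (ι (P x)) = 0 := fun k =>
    h.koenigsCoeff_spectralProj_of_ne hT hP (hne k) x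
  -- The index `0` is arbitrary, since every coefficient vanishes.
  rw [h.eq_koenigsProj_of_koenigsCoeff_eq_zero (n := 0) fun k _ => hc k, koenigsProj_eq, hc,
    zero_smul, zero_apply, map_zero]

theorem IsSchroeder.spectralProj_eq_koenigsProj (h : IsSchroeder φ α)
    (hT : ∀ x, ι (T x) = compOp φ h.hol (ι x)) (hP : IsSpectralProj T μ P) {n : ℕ}
    (hn : eigenval φ α n = μ) (x : X) : ι (P x) = koenigsProj φ α n (ι x) := by
  rw [h.eq_koenigsProj_of_koenigsCoeff_eq_zero (f := ι (P x)) (n := n) fun k hk =>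
      h.koenigsCoeff_spectralProj_of_ne hT hP (fun hk' => hk (h.eigenval_injective
        (hk'.trans hn.symm))) x,
    koenigsProj_eq, koenigsProj_eq, h.koenigsCoeff_spectralProj_of_eq hT hP hn]

theorem IsSchroeder.isSimplePole (h : IsSchroeder φ α) (hι : Function.Injective ι)
    (hT : ∀ x, ι (T x) = compOp φ h.hol (ι x)) (hP : IsSpectralProj T μ P) {n : ℕ}
    (hn : eigenval φ α n = μ) : IsSimplePole T μ := by
  have hPx : ∀ x, ι (P x) = koenigsCoeff φ α n (ι x) • koenigs φ α ^ n := fun x => by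
    rw [h.spectralProj_eq_koenigsProj hT hP hn, koenigsProj_eq]
  refine hP.isSimplePole (ContinuousLinearMap.ext fun x => hι ?_) ?_
  · rw [Algebra.algebraMap_eq_smul_one, mul_apply_eq_comp, sub_apply, map_sub, hT,
      hPx, map_smul, h.compOp_koenigs_pow, hn]
    simp [hPx, smul_comm μ]
  · obtain ⟨x₀, hx₀⟩ : ∃ x, P x ≠ 0 := by
      by_contra! hz
      exact hP.ne_zero (ContinuousLinearMap.ext hz)
    have hc : koenigsCoeff φ α n (ι x₀) ≠ 0 := fun hc => hx₀ (hι (by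
      rw [hPx, hc, zero_smul, map_zero]))
    -- All `ι (P x)` are multiples of `κ ^ n`, so any nonzero `P x₀` spans the range; this avoids
    -- showing separately that `κ ^ n` comes from `X`.
    refine finrank_eq_one_iff'.2 ⟨⟨P x₀, x₀, rfl⟩, fun h0 => hx₀ (congrArg Subtype.val h0), ?_⟩
    rintro ⟨_, x, rfl⟩
    refine ⟨koenigsCoeff φ α n (ι x) / koenigsCoeff φ α n (ι x₀), Subtype.ext (hι ?_)⟩
    change ι (_ • P x₀) = ι (P x)
    rw [map_smul, hPx, hPx, smul_smul, div_mul_cancel₀ _ hc]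

end Restriction

end HolDisc

end

theorem theorem5p5 {X : Type*} [NormedAddCommGroup X] [NormedSpace ℂ X] [CompleteSpace X]
    (φ : HolDisc.Disc → HolDisc.Disc) (α : HolDisc.Disc) (hφ : HolDisc.IsSchroeder φ α)
    (ι : X →L[ℂ] HolDisc.Hol) (hι : Function.Injective ι)
    (hinv : ∀ x, ∃ y, ι y = HolDisc.compOp φ hφ.hol (ι x))
    (μ : ℂ) (hμ0 : μ ≠ 0)
    (hμ : HolDisc.IsIsolatedSpec (HolDisc.restrictOp φ hφ.hol ι hι hinv) μ) :
    ∃ n : ℕ, μ = HolDisc.eigenval φ α n ∧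
      HolDisc.IsSimplePole (HolDisc.restrictOp φ hφ.hol ι hι hinv) μ ∧
      (∀ x, ∃ y, ι y = HolDisc.koenigsProj φ α n (ι x)) ∧
      ∃ P : X →L[ℂ] X, HolDisc.IsSpectralProj (HolDisc.restrictOp φ hφ.hol ι hι hinv) μ P ∧
        ∀ x, ι (P x) = HolDisc.koenigsProj φ α n (ι x) := by
  have hT := HolDisc.restrictOp_spec φ hφ.hol ι hι hinv
  obtain ⟨P, hP⟩ := hμ.exists_isSpectralProj
  obtain ⟨n, hn⟩ := hφ.exists_eigenval_eq hι hT hP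
  have hPn := hφ.spectralProj_eq_koenigsProj hT hP hn
  exact ⟨n, hn.symm, hφ.isSimplePole hι hT hP hn, fun x => ⟨P x, hPn x⟩, P, hP, hPn⟩
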